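/- \textbf{Definitions.} A topological space is \emph{locally Polish} if it has a countable basis of open sets each of which is a Polish space in the relative topology. A \emph{Polish groupoid} is a groupoid $G$ (a small category all of whose arrows are invertible; $G$ also denotes its set of arrows, $s$ and $r$ the source and range maps, and objects are identified with their identity arrows) endowed with a locally Polish topology on the set of arrows such that: (1) composition, defined on the subspace $\{(\gamma,\rho)\in G\times G: s(\gamma)=r(\rho)\}$ of $G\times G$, and inversion are continuous and open; (2) the set $G^0$ of objects is a Polish space in the subspace topology; (3) for every object $a$ the sets $Ga=s^{-1}(\{a\})$ and $aG=r^{-1}(\{a\})$ are Polish spaces in the subspace topology. A \emph{Polish $G$-space} is a Polish space $X$ with a continuous map $p:X\to G^0$ and a continuous map $(\gamma,x)\mapsto\gamma x$ from $\{(\gamma,x)\in G\times X: s(\gamma)=p(x)\}$ to $X$ such that $p(\gamma x)=r(\gamma)$, $\gamma(\rho x)=(\gamma\rho)x$ and $p(x)x=x$ whenever these are defined. The orbit of $x\in X$ is $[x]=\{\gamma x: \gamma\in G,\ s(\gamma)=p(x)\}$, and the orbit equivalence relation is $E_G^X=\{(x,y)\in X\times X:[x]=[y]\}$. The Borel classes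 of $X$ are defined for countable ordinals $\alpha\ge 1$: $\mathbf{\Sigma}^0_1$ consists of the open sets, $\mathbf{\Pi}^0_\alpha$ consists of the complements of $\mathbf{\Sigma}^0_\alpha$ sets, and for $\alpha>1$ the class $\mathbf{\Sigma}^0_\alpha$ consists of the sets $\bigcup_{n\in\mathbb{N}}A_n$ where each $A_n$ is $\mathbf{\Pi}^0_{\beta_n}$ for some $1\le\beta_n<\alpha$. \textbf{Theorem.} Let $G$ be a Polish groupoid and let $X$ be a Polish $G$-space. Then $E_G^X$ is a Borel subset of $X\times X$ if and only if there is a countable ordinal $\alpha\ge 1$ such that for every $x\in X$ the orbit $[x]$ is a $\mathbf{\Pi}^0_\alpha$ subset of $X$. -/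

import Mathlib

open CategoryTheory Set TopologicalSpace MeasureTheory
open scoped Ordinal

universe u v w

/-- A locally Polish space: a topological space with a countable basis of open sets, each of which
is a Polish space in the relative topology. (It need not be Hausdorff.) -/
def IsLocallyPolish (Y : Type*) [TopologicalSpace Y] : Prop :=
  ∃ B : Set (Set Y), B.Countable ∧ IsTopologicalBasis B ∧ ∀ U ∈ B, PolishSpace U

namespace TopGroupoid

section Groupoid

variable (C : Type u) [Groupoid.{v} C]

/-- The identity arrow of an object. Objects are identified with their identity arrows. -/
def unitArrow (x : C) : Arrow C := Arrow.mk (𝟙 x)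

/-- The set `G⁰` of objects, as a subset of the set of arrows. -/
def units : Set (Arrow C) := Set.range (unitArrow C)

/-- The set `Gx` of arrows with source `x`. -/
def sourceFiber (x : C) : Set (Arrow C) := {γ | γ.left = x}

/-- The set `xG` of arrows with range `x`. -/
def rangeFiber (x : C) : Set (Arrow C) := {γ | γ.right = x}

/-- The set `G²` of composable pairs `(γ, ρ)`: the source of `γ` is the range of `ρ`. -/
abbrev ComposablePairs : Type (max u v) :=
  {q : Arrow C × Arrow C // q.1.left = q.2.right}

/-- Composition of arrows `(γ, ρ) ↦ γρ` (first `ρ`, then `γ`). -/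
def compArrow (q : ComposablePairs C) : Arrow C :=
  Arrow.mk (q.1.2.hom ≫ eqToHom q.2.symm ≫ q.1.1.hom)

/-- Inversion of arrows. -/
def invArrow (γ : Arrow C) : Arrow C := Arrow.mk (Groupoid.inv γ.hom)

/-- A Polish groupoid: a groupoid whose set of arrows carries a locally Polish topology such that
composition (on composable pairs, with the subspace topology) and inversion are continuous and
open, and such that the set of objects and all the source and range fibers are Polish spaces
in the subspace topology. -/
structure IsPolishGroupoid [TopologicalSpace (Arrow C)] : Prop where
  locallyPolish : IsLocallyPolish (Arrow C)
  continuous_comp : Continuous (compArrow C)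
  isOpenMap_comp : IsOpenMap (compArrow C)
  continuous_inv : Continuous (invArrow C)
  isOpenMap_inv : IsOpenMap (invArrow C)
  polish_units : PolishSpace (units C)
  polish_sourceFiber : ∀ x : C, PolishSpace (sourceFiber C x)
  polish_rangeFiber : ∀ x : C, PolishSpace (rangeFiber C x)

end Groupoid

/-- A continuous action of a groupoid, with a topology on its arrows, on a topological space `X`:
a continuous anchor map `p` from `X` to the objects (topologized as the subspace of identity
arrows) and a continuous map `(γ, x) ↦ γx` to `X`, defined for the pairs such that `p x` is the
source of `γ`. An arrow `γ : a ⟶ b` takes points over `a` to points over `b`, which is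
the axiom `p (γx) = r(γ)`. -/
structure ContinuousAction (C : Type u) [Groupoid.{v} C] [TopologicalSpace (Arrow C)]
    (X : Type w) [TopologicalSpace X] where
  anchor : X → C
  act : ∀ {a b : C}, (a ⟶ b) → {x : X // anchor x = a} → {x : X // anchor x = b}
  act_id : ∀ (a : C) (x : {x : X // anchor x = a}), act (𝟙 a) x = x
  act_comp : ∀ {a b c : C} (ρ : a ⟶ b) (γ : b ⟶ c) (x : {x : X // anchor x = a}),
    act γ (act ρ x) = act (ρ ≫ γ) x
  continuous_anchor : Continuous fun x : X => unitArrow C (anchor x)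
  continuous_act : Continuous fun q : {q : Arrow C × X // anchor q.2 = q.1.left} =>
    (act q.1.1.hom ⟨q.1.2, q.2⟩ : X)

namespace ContinuousAction

variable {C : Type u} [Groupoid.{v} C] [TopologicalSpace (Arrow C)]
  {X : Type w} [TopologicalSpace X]

/-- The orbit `[x]` of a point: all `γx`, where `γ` has source `p x`. -/
def orbit (σ : ContinuousAction C X) (x : X) : Set X :=
  {y | ∃ (b : C) (γ : σ.anchor x ⟶ b), (σ.act γ ⟨x, rfl⟩ : X) = y}

/-- The orbit equivalence relation, as a subset of `X × X`: two points are equivalent when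
their orbits are equal. -/
def orbitRel (σ : ContinuousAction C X) : Set (X × X) :=
  {q | σ.orbit q.1 = σ.orbit q.2}

end ContinuousAction

end TopGroupoid

/-- The additive Borel classes `Σ⁰_α` (`1 ≤ α`): `Σ⁰_1` consists of the open sets and, for `1 < α`,
`Σ⁰_α` consists of the countable unions of sets `A n` in `Π⁰_(β n)` with `1 ≤ β n < α`; here
`Π⁰_β` is the class of complements of sets in `Σ⁰_β`. No set belongs to the class for `α = 0`. -/
inductive IsSigmaZero {X : Type w} [TopologicalSpace X] : Ordinal.{0} → Set X → Prop
  | of_isOpen (U : Set X) (hU : IsOpen U) : IsSigmaZero 1 U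
  | iUnion (α : Ordinal.{0}) (hα : 1 < α) (β : ℕ → Ordinal.{0}) (hβ : ∀ n, 1 ≤ β n ∧ β n < α)
      (A : ℕ → Set X) (hA : ∀ n, IsSigmaZero (β n) (A n)ᶜ) : IsSigmaZero α (⋃ n, A n)

/-- The multiplicative Borel classes `Π⁰_α`: complements of sets in `Σ⁰_α`. -/
def IsPiZero {X : Type w} [TopologicalSpace X] (α : Ordinal.{0}) (A : Set X) : Prop :=
  IsSigmaZero α Aᶜ

/-! ### Borel classes. -/

section BorelHierarchy

variable {X : Type*} [TopologicalSpace X]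

/-! If `E` is Borel, its complement lies in one class `Σ⁰_α` with `α` countable. Orbits are sections
of `E`, hence continuous preimages, and all inherit that `α`.

Conversely, `HjorthLE` is a back-and-forth comparison of pieces of orbits. Points of one orbit are
comparable at every rank, by translating with an arrow (`Carries.hjorthLE`). Rank `α` comparison
transfers `Π⁰_α` membership of generic points (`HjorthLE.eventually_notMem`). So if `[y]` is `Π⁰_α`
and `x` is below `y` at rank `α` on full source fibers, a generic `γ` satisfies `γx ∈ [y]`, and the
orbits agree. Thus `E` equals a rank `α` comparison, which is Borel for countable `α`
(`measurableSet_hjorthLE`). -/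

theorem IsSigmaZero.one_le {α : Ordinal.{0}} {A : Set X} (h : IsSigmaZero α A) : 1 ≤ α := by
  cases h with
  | of_isOpen _ hU => exact le_rfl
  | iUnion _ hα _ _ _ _ => exact hα.le

theorem IsSigmaZero.preimage {Y : Type*} [TopologicalSpace Y] {α : Ordinal.{0}} {A : Set Y}
    (h : IsSigmaZero α A) {f : X → Y} (hf : Continuous f) : IsSigmaZero α (f ⁻¹' A) := by
  induction h with
  | of_isOpen U hU => exact .of_isOpen _ (hU.preimage hf)
  | iUnion α hα β hβ A _ ih =>
    rw [preimage_iUnion]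
    exact .iUnion α hα β hβ _ ih

theorem IsSigmaZero.measurableSet [MeasurableSpace X] [OpensMeasurableSpace X]
    {α : Ordinal.{0}} {A : Set X} (h : IsSigmaZero α A) : MeasurableSet A := by
  induction h with
  | of_isOpen U hU => exact hU.measurableSet
  | iUnion α hα β hβ A _ ih => exact .iUnion fun n => (ih n).of_compl

theorem IsSigmaZero.compl {α : Ordinal.{0}} {A : Set X} (h : IsSigmaZero α A) :
    IsSigmaZero (Order.succ α) Aᶜ := by
  have := IsSigmaZero.iUnion (Order.succ α) (Order.lt_succ_of_le h.one_le) (fun _ => α)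
    (fun _ => ⟨h.one_le, Order.lt_succ α⟩) (fun _ => Aᶜ) (fun _ => by rwa [compl_compl])
  rwa [iUnion_const] at this

theorem succ_lt_omega_one {α : Ordinal.{0}} (h : α < ω₁) : Order.succ α < ω₁ :=
  (Cardinal.isSuccLimit_omega 1).succ_lt h

theorem countable_Iio_of_lt_omega_one {α : Ordinal.{0}} (h : α < ω₁) : Countable (Iio α) := by
  rw [← Cardinal.mk_le_aleph0_iff, Cardinal.mk_Iio_ordinal, Cardinal.lift_le_aleph0]
  rw [← Cardinal.ord_aleph, Cardinal.lt_ord, ← Cardinal.succ_aleph0, Order.lt_succ_iff] at h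
  exact h

/-- Every Borel set belongs to an additive Borel class of countable index. -/
theorem exists_isSigmaZero_of_measurableSet {A : Set X} (hA : MeasurableSet[borel X] A) :
    ∃ α < ω₁, IsSigmaZero α A := by
  induction A, hA using MeasurableSpace.generateFrom_induction with
  | hC U hU _ => exact ⟨1, Ordinal.one_lt_omega0.trans_le (Ordinal.omega0_le_omega 1), .of_isOpen U hU⟩
  | empty =>
    exact ⟨1, Ordinal.one_lt_omega0.trans_le (Ordinal.omega0_le_omega 1), .of_isOpen ∅ isOpen_empty⟩
  | compl A _ ih =>
    obtain ⟨α, hα, h⟩ := ih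
    exact ⟨_, succ_lt_omega_one hα, h.compl⟩
  | iUnion A _ ih =>
    choose α hα h using ih
    have hs : (⨆ n, Order.succ (α n)) < ω₁ :=
      Ordinal.iSup_lt_omega_one fun n => succ_lt_omega_one (hα n)
    have hle : ∀ n, Order.succ (α n) ≤ ⨆ n, Order.succ (α n) := Ordinal.le_iSup _
    -- Since `(A n)ᶜ` is `Σ⁰` of rank `succ (α n)`, each `A n` is `Π⁰` of that rank; monotonicity of
    -- the classes is not needed.
    refine ⟨_, succ_lt_omega_one hs, .iUnion _ ?_ (fun n => Order.succ (α n)) ?_ A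
      fun n => (h n).compl⟩
    · exact Order.lt_succ_of_le ((h 0).compl.one_le.trans (hle 0))
    · exact fun n => ⟨(h n).compl.one_le, Order.lt_succ_of_le (hle n)⟩

end BorelHierarchy

/-! ### Translations in the groupoid. -/

namespace TopGroupoid

section Groupoid

variable {C : Type u} [Groupoid.{v} C]

/-- Right multiplication by an arrow `k : a ⟶ b`, as a map between source fibers. -/
def rightMul {a b : C} (k : a ⟶ b) (γ : sourceFiber C b) : sourceFiber C a :=
  ⟨compArrow C ⟨(γ.1, Arrow.mk k), γ.2⟩, rfl⟩

theorem rightMul_mk {a b c : C} (k : a ⟶ b) (g : b ⟶ c) :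
    rightMul k ⟨Arrow.mk g, rfl⟩ = ⟨Arrow.mk (k ≫ g), rfl⟩ := by
  apply Subtype.ext
  simp [rightMul, compArrow]

theorem rightMul_inv_rightMul {a b : C} (k : a ⟶ b) (γ : sourceFiber C b) :
    rightMul (Groupoid.inv k) (rightMul k γ) = γ := by
  obtain ⟨⟨l, r, g⟩, h⟩ := γ
  obtain rfl : l = b := h
  refine (congrArg _ (rightMul_mk k g)).trans ((rightMul_mk _ _).trans (Subtype.ext ?_))
  exact congrArg Arrow.mk (by rw [← Category.assoc, Groupoid.inv_comp, Category.id_comp])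

variable [TopologicalSpace (Arrow C)]

theorem IsPolishGroupoid.continuous_rightMul (hC : IsPolishGroupoid C) {a b : C} (k : a ⟶ b) :
    Continuous (rightMul k) :=
  (hC.continuous_comp.comp (Continuous.subtype_mk
    (continuous_subtype_val.prodMk continuous_const) _)).subtype_mk _

/-- The set of sources of the arrows in an open set is relatively open in the set of objects. -/
theorem IsPolishGroupoid.exists_isOpen_unitArrow_mem_iff (hC : IsPolishGroupoid C)
    {W : Set (Arrow C)} (hW : IsOpen W) :
    ∃ S : Set (Arrow C), IsOpen S ∧ ∀ a : C, unitArrow C a ∈ S ↔ ∃ γ ∈ W, γ.left = a := by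
  -- The witness is `W⁻¹W`: it contains `γ⁻¹γ` for `γ ∈ W`, and a unit in it has the source of its
  -- right factor.
  refine ⟨compArrow C '' {q | q.1.1 ∈ invArrow C '' W ∧ q.1.2 ∈ W}, hC.isOpenMap_comp _ ?_, ?_⟩
  · exact ((hC.isOpenMap_inv W hW).preimage (continuous_fst.comp continuous_subtype_val)).inter
      (hW.preimage (continuous_snd.comp continuous_subtype_val))
  · intro a
    constructor
    · rintro ⟨⟨⟨γ, ρ⟩, h⟩, ⟨-, hρ⟩, heq⟩
      exact ⟨ρ, hρ, congrArg Comma.left heq⟩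
    · rintro ⟨γ, hγ, rfl⟩
      refine ⟨⟨(invArrow C γ, γ), rfl⟩, ⟨mem_image_of_mem _ hγ, hγ⟩, ?_⟩
      simp [compArrow, invArrow, unitArrow]

end Groupoid

/-! ### Orbit maps. -/

namespace ContinuousAction

variable {C : Type u} [Groupoid.{v} C] [TopologicalSpace (Arrow C)]
  {X : Type w} [TopologicalSpace X] (σ : ContinuousAction C X)

/-- The map `γ ↦ γx` on the arrows whose source is the anchor of `x`. -/
def orbitMap (x : X) (γ : sourceFiber C (σ.anchor x)) : X :=
  σ.act γ.1.hom ⟨x, γ.2.symm⟩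

theorem continuous_orbitMap (x : X) : Continuous (σ.orbitMap x) :=
  σ.continuous_act.comp
    (f := fun γ : sourceFiber C (σ.anchor x) =>
      (⟨(γ.1, x), γ.2.symm⟩ : {q : Arrow C × X // σ.anchor q.2 = q.1.left}))
    (Continuous.subtype_mk (continuous_subtype_val.prodMk continuous_const) _)

theorem range_orbitMap (x : X) : range (σ.orbitMap x) = σ.orbit x := by
  ext y
  constructor
  · rintro ⟨⟨⟨l, r, g⟩, h⟩, rfl⟩
    obtain rfl : l = σ.anchor x := h
    exact ⟨r, g, rfl⟩
  · rintro ⟨b, γ, rfl⟩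
    exact ⟨⟨Arrow.mk γ, rfl⟩, rfl⟩

/-- The arrow `h` carries `y` to `x`. -/
def Carries {x y : X} (h : σ.anchor y ⟶ σ.anchor x) : Prop :=
  σ.act h ⟨y, rfl⟩ = ⟨x, rfl⟩

variable {σ}

theorem Carries.inv {x y : X} {h : σ.anchor y ⟶ σ.anchor x} (hh : σ.Carries h) :
    σ.Carries (Groupoid.inv h) := by
  unfold Carries at hh ⊢
  rw [← hh, σ.act_comp, Groupoid.comp_inv, σ.act_id]

theorem Carries.orbitMap_rightMul {x y : X} {h : σ.anchor y ⟶ σ.anchor x} (hh : σ.Carries h)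
    (γ : sourceFiber C (σ.anchor x)) : σ.orbitMap y (rightMul h γ) = σ.orbitMap x γ := by
  obtain ⟨⟨l, r, g⟩, hl⟩ := γ
  obtain rfl : l = σ.anchor x := hl
  have key : σ.act g ⟨x, rfl⟩ = σ.act (h ≫ g) ⟨y, rfl⟩ := by
    rw [← σ.act_comp, show σ.act h ⟨y, rfl⟩ = ⟨x, rfl⟩ from hh]
  have := congrArg Subtype.val key
  simpa [orbitMap, rightMul, compArrow] using this.symm

theorem mem_orbit_iff {x y : X} :
    x ∈ σ.orbit y ↔ ∃ h : σ.anchor y ⟶ σ.anchor x, σ.Carries h := by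
  constructor
  · rintro ⟨b, h, rfl⟩
    have e := (σ.act h ⟨y, rfl⟩).2
    refine ⟨h ≫ eqToHom e.symm, ?_⟩
    unfold Carries
    -- With the image point a variable, `b` can be replaced by its anchor and the transport becomes
    -- an identity.
    generalize hz : σ.act h ⟨y, rfl⟩ = z at *
    obtain ⟨z, rfl⟩ := z
    simp [hz]
  · rintro ⟨h, hh⟩
    exact ⟨_, h, congrArg Subtype.val hh⟩

theorem mem_orbit_self (x : X) : x ∈ σ.orbit x :=
  ⟨_, 𝟙 _, by rw [σ.act_id]⟩

theorem orbit_eq_iff {x y : X} : σ.orbit x = σ.orbit y ↔ x ∈ σ.orbit y := by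
  constructor
  · intro h
    exact h ▸ mem_orbit_self x
  · intro h
    have sub : ∀ {x y : X}, x ∈ σ.orbit y → σ.orbit x ⊆ σ.orbit y := by
      intro x y h
      obtain ⟨k, hk⟩ := mem_orbit_iff.1 h
      rw [← range_orbitMap, ← range_orbitMap]
      rintro _ ⟨γ, rfl⟩
      exact ⟨_, hk.orbitMap_rightMul γ⟩
    obtain ⟨k, hk⟩ := mem_orbit_iff.1 h
    exact (sub h).antisymm (sub (mem_orbit_iff.2 ⟨_, hk.inv⟩))

/-! ### Partial orbits and Hjorth's comparison. -/

variable (σ)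

/-- `V x`: the points `γx` with `γ ∈ V`. -/
def partialOrbit (x : X) (V : Set (Arrow C)) : Set X :=
  σ.orbitMap x '' {γ | γ.1 ∈ V}

/-- `V` contains an arrow whose source is the anchor of `x`. -/
def Meets (x : X) (V : Set (Arrow C)) : Prop :=
  ∃ γ ∈ V, γ.left = σ.anchor x

theorem isOpen_setOf_meets (hC : IsPolishGroupoid C) {V : Set (Arrow C)} (hV : IsOpen V) :
    IsOpen {x | σ.Meets x V} := by
  obtain ⟨S, hS, hSV⟩ := hC.exists_isOpen_unitArrow_mem_iff hV
  convert hS.preimage σ.continuous_anchor using 1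
  ext x
  exact (hSV _).symm

/-- A fixed `γ` cannot act on nearby points with other anchors. Instead, openness of the source map
supplies arrows near `γ`, and joint continuity keeps the result in `O`. -/
theorem isOpen_setOf_partialOrbit_inter (hC : IsPolishGroupoid C) {V : Set (Arrow C)}
    (hV : IsOpen V) {O : Set X} (hO : IsOpen O) :
    IsOpen {x | (σ.partialOrbit x V ∩ O).Nonempty} := by
  rw [isOpen_iff_mem_nhds]
  rintro x ⟨_, ⟨γ, hγ, rfl⟩, hγO⟩
  have hpre := hO.preimage σ.continuous_act
  obtain ⟨T, hT, hTeq⟩ := isOpen_induced_iff.1 hpre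
  have hmem : (γ.1, x) ∈ T := by
    have : (⟨(γ.1, x), γ.2.symm⟩ : {q : Arrow C × X // σ.anchor q.2 = q.1.left}) ∈
      Subtype.val ⁻¹' T := by rw [hTeq]; exact hγO
    exact this
  obtain ⟨V', O', hV', hO', hγV', hxO', hsub⟩ := isOpen_prod_iff.1 hT _ _ hmem
  refine Filter.mem_of_superset (((σ.isOpen_setOf_meets hC (hV.inter hV')).inter hO').mem_nhds
    ⟨⟨γ.1, ⟨hγ, hγV'⟩, γ.2⟩, hxO'⟩) ?_
  rintro z ⟨⟨ρ, ⟨hρV, hρV'⟩, hρ⟩, hz⟩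
  refine ⟨_, ⟨⟨ρ, hρ⟩, hρV, rfl⟩, ?_⟩
  have : (⟨(ρ, z), hρ.symm⟩ : {q : Arrow C × X // σ.anchor q.2 = q.1.left}) ∈
      Subtype.val ⁻¹' T := hsub ⟨hρV', hz⟩
  rw [hTeq] at this
  exact this

/-- Hjorth's comparison relation of rank `α` between the pieces `V₀ x` and `V₁ y`, relative to a
family `B` of sets of arrows. -/
def HjorthLE (B : Set (Set (Arrow C))) (α : Ordinal.{0}) (x : X) (V₀ : Set (Arrow C)) (y : X)
    (V₁ : Set (Arrow C)) : Prop :=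
  σ.partialOrbit x V₀ ⊆ closure (σ.partialOrbit y V₁) ∧
    ∀ β : Iio α, ∀ W₀ ∈ B, W₀ ⊆ V₀ → σ.Meets x W₀ →
      ∃ W₁ ∈ B, W₁ ⊆ V₁ ∧ σ.Meets y W₁ ∧ HjorthLE B β.1 y W₁ x W₀
termination_by α
decreasing_by exact β.2

variable {σ}

/-- Right translation by `h` preserves the point reached, so a move `W₀` is answered by a basic
neighborhood of `γh` inside its translate. The exchanged comparison then uses `h⁻¹`. -/
theorem Carries.hjorthLE (hC : IsPolishGroupoid C) {B : Set (Set (Arrow C))}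
    (hB : IsTopologicalBasis B) (α : Ordinal.{0}) :
    ∀ {x y : X} {h : σ.anchor y ⟶ σ.anchor x}, σ.Carries h → ∀ {V₀ V₁ : Set (Arrow C)},
      IsOpen V₁ → (∀ γ : sourceFiber C (σ.anchor x), γ.1 ∈ V₀ → (rightMul h γ).1 ∈ V₁) →
      σ.HjorthLE B α x V₀ y V₁ := by
  induction α using WellFoundedLT.induction with
  | ind α ih =>
    intro x y h hh V₀ V₁ hV₁ hsub
    rw [HjorthLE]
    refine ⟨subset_trans ?_ subset_closure, ?_⟩
    · rintro _ ⟨γ, hγ, rfl⟩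
      exact ⟨_, hsub γ hγ, hh.orbitMap_rightMul γ⟩
    · rintro ⟨β, hβ⟩ W₀ hW₀ hW₀V ⟨γ, hγ, hγx⟩
      have hcont := hC.continuous_rightMul (Groupoid.inv h)
      obtain ⟨T, hT, hTeq⟩ := isOpen_induced_iff.1
        (((hB.isOpen hW₀).preimage continuous_subtype_val).preimage hcont)
      have hTmem : ∀ ρ : sourceFiber C (σ.anchor y),
          ρ.1 ∈ T ↔ (rightMul (Groupoid.inv h) ρ).1 ∈ W₀ := fun ρ => Set.ext_iff.1 hTeq ρ
      have hγT : (rightMul h ⟨γ, hγx⟩).1 ∈ T := by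
        rw [hTmem, rightMul_inv_rightMul]
        exact hγ
      obtain ⟨W₁, hW₁, hmem, hW₁sub⟩ := hB.exists_subset_of_mem_open
        (⟨hγT, hsub ⟨γ, hγx⟩ (hW₀V hγ)⟩ : (rightMul h ⟨γ, hγx⟩).1 ∈ T ∩ V₁) (hT.inter hV₁)
      refine ⟨W₁, hW₁, hW₁sub.trans inter_subset_right, ⟨_, hmem, (rightMul h ⟨γ, hγx⟩).2⟩, ?_⟩
      exact ih β hβ hh.inv (hB.isOpen hW₀) fun ρ hρ => (hTmem ρ).1 (hW₁sub hρ).1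

/-- Closure inclusion is tested on a countable basis through open conditions, and the remaining
quantifiers range over the countable sets `B` and `Iio α`. -/
theorem measurableSet_hjorthLE [SecondCountableTopology X] [MeasurableSpace X] [BorelSpace X]
    (hC : IsPolishGroupoid C) {B : Set (Set (Arrow C))} (hBc : B.Countable)
    (hB : ∀ W ∈ B, IsOpen W) {α : Ordinal.{0}} (hα : α < ω₁) :
    ∀ {V₀ V₁ : Set (Arrow C)}, IsOpen V₀ → IsOpen V₁ →
      MeasurableSet {q : X × X | σ.HjorthLE B α q.1 V₀ q.2 V₁} := by
  induction α using WellFoundedLT.induction with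
  | ind α ih =>
    intro V₀ V₁ hV₀ hV₁
    have hm : ∀ {P Q : X → Prop}, IsOpen {x | P x} → IsOpen {x | Q x} →
        MeasurableSet {q : X × X | P q.1} ∧ MeasurableSet {q : X × X | Q q.2} := fun hP hQ =>
      ⟨measurable_fst hP.measurableSet, measurable_snd hQ.measurableSet⟩
    have : Countable (Iio α) := countable_Iio_of_lt_omega_one hα
    have hset : {q : X × X | σ.HjorthLE B α q.1 V₀ q.2 V₁} =
        {q | ∀ O ∈ countableBasis X, (σ.partialOrbit q.1 V₀ ∩ O).Nonempty →
          (σ.partialOrbit q.2 V₁ ∩ O).Nonempty} ∩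
        {q | ∀ β : Iio α, ∀ W₀ ∈ B, W₀ ⊆ V₀ → σ.Meets q.1 W₀ →
          ∃ W₁ ∈ B, W₁ ⊆ V₁ ∧ σ.Meets q.2 W₁ ∧ σ.HjorthLE B β.1 q.2 W₁ q.1 W₀} := by
      ext q
      rw [mem_ofPred_eq, HjorthLE]
      refine and_congr_left' ?_
      constructor
      · rintro h O hO ⟨z, hz, hzO⟩
        have := mem_closure_iff.1 (h hz) O (isOpen_of_mem_countableBasis hO) hzO
        rwa [inter_comm] at this
      · intro h z hz
        rw [(isBasis_countableBasis X).mem_closure_iff]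
        intro O hO hzO
        have := h O hO ⟨z, hz, hzO⟩
        rwa [inter_comm] at this
    rw [hset]
    refine .inter ?_ ?_
    · simp only [ofPred_forall]
      refine .biInter (countable_countableBasis X) fun O hO => ?_
      have hO' := isOpen_of_mem_countableBasis hO
      exact (hm (σ.isOpen_setOf_partialOrbit_inter hC hV₀ hO')
        (σ.isOpen_setOf_partialOrbit_inter hC hV₀ hO')).1.imp
        (hm (σ.isOpen_setOf_partialOrbit_inter hC hV₁ hO')
        (σ.isOpen_setOf_partialOrbit_inter hC hV₁ hO')).2
    · simp only [ofPred_forall]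
      refine .iInter fun β => .biInter hBc fun W₀ hW₀ => .iInter fun _ => ?_
      have h₀ := σ.isOpen_setOf_meets hC (hB W₀ hW₀)
      refine (hm h₀ h₀).1.imp ?_
      have : {q : X × X | ∃ W₁ ∈ B, W₁ ⊆ V₁ ∧ σ.Meets q.2 W₁ ∧ σ.HjorthLE B β.1 q.2 W₁ q.1 W₀} =
          ⋃ W₁ ∈ {W ∈ B | W ⊆ V₁}, {q : X × X | σ.Meets q.2 W₁} ∩
            Prod.swap ⁻¹' {q : X × X | σ.HjorthLE B β.1 q.1 W₁ q.2 W₀} := by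
        ext q
        simp only [mem_ofPred_eq, mem_iUnion, exists_prop, mem_inter_iff, mem_preimage, Prod.fst_swap,
          Prod.snd_swap, and_assoc]
      rw [this]
      refine .biUnion (hBc.mono (sep_subset _ _)) fun W₁ hW₁ => ?_
      have h₁ := σ.isOpen_setOf_meets hC (hB W₁ hW₁.1)
      exact (hm h₁ h₁).2.inter (measurable_swap
        (ih β.1 β.2 (lt_trans β.2 hα) (hB W₁ hW₁.1) (hB W₀ hW₀)))

/-- If `V₀ x` is below `V₁ y` at rank `α`, then a `Π⁰_α` set (given by its complement `S`)
containing generic points of `V₁ y` contains generic points of `V₀ x`. -/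
theorem HjorthLE.eventually_notMem (hC : IsPolishGroupoid C) {B : Set (Set (Arrow C))}
    (hB : IsTopologicalBasis B) {α : Ordinal.{0}} {S : Set X} (hS : IsSigmaZero α S) :
    ∀ {x y : X} {V₀ V₁ : Set (Arrow C)}, IsOpen V₀ → IsOpen V₁ → σ.HjorthLE B α x V₀ y V₁ →
      (∀ᶠ γ in residual _, γ.1 ∈ V₁ → σ.orbitMap y γ ∉ S) →
      ∀ᶠ γ in residual _, γ.1 ∈ V₀ → σ.orbitMap x γ ∉ S := by
  have hbaire : ∀ a : C, BaireSpace (sourceFiber C a) := fun a =>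
    have := hC.polish_sourceFiber a
    inferInstance
  induction hS with
  | of_isOpen U hU =>
    intro x y V₀ V₁ hV₀ hV₁ hle hy
    rw [HjorthLE] at hle
    refine Filter.Eventually.of_forall fun γ hγ hγU => ?_
    obtain ⟨_, hzU, ρ, hρ, rfl⟩ := mem_closure_iff.1 (hle.1 ⟨γ, hγ, rfl⟩) U hU hγU
    obtain ⟨ρ', ⟨h₁, h₂⟩, h₃⟩ := (dense_of_mem_residual hy).inter_open_nonempty _
      ((hV₁.preimage continuous_subtype_val).inter (hU.preimage (σ.continuous_orbitMap y)))
      ⟨ρ, hρ, hzU⟩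
    exact h₃ h₁ h₂
  | iUnion α hα β hβ A hA ih =>
    intro x y V₀ V₁ hV₀ hV₁ hle hy
    simp only [mem_iUnion, not_exists]
    suffices h : ∀ n, ∀ᶠ γ in residual (sourceFiber C (σ.anchor x)),
        γ.1 ∈ V₀ → σ.orbitMap x γ ∉ A n by
      filter_upwards [eventually_countable_forall.2 h] with γ hγ hγV n using hγ n hγV
    intro n
    borelize X
    let : MeasurableSpace (sourceFiber C (σ.anchor x)) := borel _
    have : BorelSpace (sourceFiber C (σ.anchor x)) := ⟨rfl⟩
    -- Baire property: the preimage of `A n` is an open `u` modulo a meager set. The aim is to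
    -- refute that `u` meets `V₀`.
    obtain ⟨u, hu, hueq⟩ := ((σ.continuous_orbitMap x).measurable
      (hA n).measurableSet.of_compl).residualEq_isOpen
    rcases ((Subtype.val ⁻¹' V₀) ∩ u).eq_empty_or_nonempty with hemp | ⟨γ, hγV, hγu⟩
    · filter_upwards [hueq.mem_iff] with γ hγ hγV hγA
      exact (hemp ▸ (⟨hγV, hγ.1 hγA⟩ : γ ∈ (Subtype.val ⁻¹' V₀) ∩ u) : γ ∈ (∅ : Set _))
    · obtain ⟨T, hT, rfl⟩ := isOpen_induced_iff.1 hu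
      obtain ⟨W₀, hW₀, hγW, hW₀sub⟩ := hB.exists_subset_of_mem_open
        (⟨hγV, hγu⟩ : γ.1 ∈ V₀ ∩ T) (hV₀.inter hT)
      rw [HjorthLE] at hle
      obtain ⟨W₁, hW₁, hW₁V, ⟨ρ, hρW, hρ⟩, hle'⟩ := hle.2 ⟨β n, (hβ n).2⟩ W₀ hW₀
        (hW₀sub.trans inter_subset_left) ⟨γ.1, hγW, γ.2⟩
      -- Generic points of `W₀ x` lie in `A n`. Induction for `(A n)ᶜ`, with the points exchanged,
      -- puts generic points of `W₁ y` in `A n`, contradicting `hy` on `W₁ ⊆ V₁`.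
      have hlarge := ih n (hB.isOpen hW₁) (hB.isOpen hW₀) hle' (by
        filter_upwards [hueq.mem_iff] with δ hδ hδW hδA
        exact hδA (hδ.2 (hW₀sub hδW).2))
      obtain ⟨δ, hδ, hδ₁, hδ₂⟩ := (dense_of_mem_residual (hlarge.and hy)).inter_open_nonempty _
        ((hB.isOpen hW₁).preimage continuous_subtype_val) ⟨⟨ρ, hρ⟩, hρW⟩
      exact (hδ₁ hδ fun hA => hδ₂ (hW₁V hδ) (mem_iUnion_of_mem n hA)).elim

theorem orbitRel_eq_setOf_hjorthLE (hC : IsPolishGroupoid C) {B : Set (Set (Arrow C))}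
    (hB : IsTopologicalBasis B) {α : Ordinal.{0}} (hα : ∀ x, IsPiZero α (σ.orbit x)) :
    σ.orbitRel = {q | σ.HjorthLE B α q.1 univ q.2 univ} := by
  ext ⟨x, y⟩
  simp only [orbitRel, mem_ofPred_eq, orbit_eq_iff]
  constructor
  · intro h
    obtain ⟨k, hk⟩ := mem_orbit_iff.1 h
    exact hk.hjorthLE hC hB α isOpen_univ fun _ _ => mem_univ _
  · intro h
    have := hC.polish_sourceFiber (σ.anchor x)
    have hres := h.eventually_notMem hC hB (hα y) isOpen_univ isOpen_univ
      (Filter.Eventually.of_forall fun γ _ hγ => hγ (σ.range_orbitMap y ▸ mem_range_self γ))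
    have : Nonempty (sourceFiber C (σ.anchor x)) := ⟨⟨unitArrow C _, rfl⟩⟩
    obtain ⟨γ, hγ⟩ := (dense_of_mem_residual hres).nonempty
    have h₁ : σ.orbitMap x γ ∈ σ.orbit y := not_not.1 (hγ (mem_univ _))
    have h₂ : σ.orbitMap x γ ∈ σ.orbit x := σ.range_orbitMap x ▸ mem_range_self γ
    rw [← orbit_eq_iff] at h₁ h₂ ⊢
    exact h₂.symm.trans h₁

end ContinuousAction

end TopGroupoid

/-! ### The equivalence. -/

theorem mainTheorem10 {C : Type u} [Groupoid.{v} C] [TopologicalSpace (Arrow C)]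
    (hC : TopGroupoid.IsPolishGroupoid C) {X : Type w} [TopologicalSpace X] [PolishSpace X]
    (σ : TopGroupoid.ContinuousAction C X) :
    MeasurableSet[borel (X × X)] σ.orbitRel ↔
      ∃ α : Ordinal.{0}, 1 ≤ α ∧ α < ω₁ ∧ ∀ x : X, IsPiZero α (σ.orbit x) := by
  constructor
  · intro h
    obtain ⟨α, hα, hS⟩ := exists_isSigmaZero_of_measurableSet h.compl
    refine ⟨α, hS.one_le, hα, fun x => ?_⟩
    unfold IsPiZero
    convert hS.preimage (Continuous.prodMk_right x) using 1
    ext y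
    simp only [mem_compl_iff, mem_preimage, TopGroupoid.ContinuousAction.orbitRel, mem_ofPred_eq]
    rw [← TopGroupoid.ContinuousAction.orbit_eq_iff, eq_comm]
  · rintro ⟨α, -, hα, h⟩
    obtain ⟨B, hBc, hB, -⟩ := hC.locallyPolish
    borelize X
    rw [← BorelSpace.measurable_eq (α := X × X),
      TopGroupoid.ContinuousAction.orbitRel_eq_setOf_hjorthLE hC hB h]
    exact TopGroupoid.ContinuousAction.measurableSet_hjorthLE hC hBc (fun W => hB.isOpen) hα
      isOpen_univ isOpen_univ
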